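/- Let $V$ be the real vector space of self-adjoint matrices in $M_2(\mathbb C)\otimes M_2(\mathbb C)\otimes M_2(\mathbb C)$ (three qubits $A,B,C$), with the bilinear pairing $\langle x,y\rangle=\mathrm{Tr}(xy^{\mathrm t})$. Let $\alpha,\beta,\gamma\subset V$ be the convex cones of un-normalized $A$-$BC$, $B$-$CA$ and $C$-$AB$ separable states, that is, of all finite sums of matrices $|\psi\rangle\langle\psi|$ with $\psi$ a product vector for the respective bipartition. For convex cones, let $\wedge$ denote the intersection and $\vee$ the convex hull of the union (equivalently, the sum). For a convex cone $\sigma\subset V$ put $\sigma^\circ=\{W\in V:\langle \varrho,W\rangle\ge 0\text{ for all }\varrho\in\sigma\}$ and $\sigma^\circ_{\mathsf X}=\sigma^\circ\cap\mathsf X$, where $\mathsf X\subset V$ is the subspace of $\mathsf X$-shaped matrices, i.e. those whose entries are zero except for diagonal and anti-diagonal entries (as $8\times 8$ matrices in the lexicographic order of the basis). Let $$Q=[\alpha\wedge(\beta\vee\gamma)]\vee[\beta\wedge(\gamma\vee\alpha)]\vee[\gamma\wedge(\alpha\vee\beta)].$$ Then $$Q^\circ=[\alpha^\circ\vee(\beta^\circ\wedge\gamma^\circ)]\wedge[\beta^\circ\vee(\gamma^\circ\wedge\alpha^\circ)]\wedge[\gamma^\circ\vee(\alpha^\circ\wedge\beta^\circ)],$$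 and $$(\alpha^\circ_{\mathsf X}\wedge\beta^\circ_{\mathsf X})\vee(\alpha^\circ_{\mathsf X}\wedge\gamma^\circ_{\mathsf X})=\alpha^\circ_{\mathsf X}\wedge Q^\circ_{\mathsf X},$$ $$(\beta^\circ_{\mathsf X}\wedge\gamma^\circ_{\mathsf X})\vee(\beta^\circ_{\mathsf X}\wedge\alpha^\circ_{\mathsf X})=\beta^\circ_{\mathsf X}\wedge Q^\circ_{\mathsf X},$$ $$(\gamma^\circ_{\mathsf X}\wedge\alpha^\circ_{\mathsf X})\vee(\gamma^\circ_{\mathsf X}\wedge\beta^\circ_{\mathsf X})=\gamma^\circ_{\mathsf X}\wedge Q^\circ_{\mathsf X}.$$ -/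

import Mathlib

namespace ThreeQubit

/-- Index set of the computational basis of `ℂ² ⊗ ℂ² ⊗ ℂ²`; `(i, j, k)` is `|i⟩_A |j⟩_B |k⟩_C`. -/
abbrev Idx : Type := Fin 2 × Fin 2 × Fin 2

/-- The 64-dimensional real vector space of three qubit self-adjoint matrices. -/
abbrev Herm : Type := selfAdjoint (Matrix Idx Idx ℂ)

/-- The un-normalized pure state `|ψ⟩⟨ψ|`. -/
def pureState (ψ : Idx → ℂ) : Herm :=
  ⟨Matrix.vecMulVec ψ (star ψ), by
    rw [selfAdjoint.mem_iff, Matrix.star_eq_conjTranspose, Matrix.conjTranspose_vecMulVec,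
      star_star]⟩

/-- `α`: the convex cone of `A`-`BC` separable un-normalized states, i.e. of the finite sums of
pure states `|ψ⟩⟨ψ|` where `ψ` is a product vector between `A` and `BC`. -/
noncomputable def alpha : PointedCone ℝ Herm :=
  PointedCone.hull ℝ {ρ | ∃ (x : Fin 2 → ℂ) (y : Fin 2 × Fin 2 → ℂ),
    ρ = pureState fun p => x p.1 * y (p.2.1, p.2.2)}

/-- `β`: the convex cone of `B`-`CA` separable un-normalized states. -/
noncomputable def beta : PointedCone ℝ Herm :=
  PointedCone.hull ℝ {ρ | ∃ (x : Fin 2 → ℂ) (y : Fin 2 × Fin 2 → ℂ),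
    ρ = pureState fun p => x p.2.1 * y (p.2.2, p.1)}

/-- `γ`: the convex cone of `C`-`AB` separable un-normalized states. -/
noncomputable def gamma : PointedCone ℝ Herm :=
  PointedCone.hull ℝ {ρ | ∃ (x : Fin 2 → ℂ) (y : Fin 2 × Fin 2 → ℂ),
    ρ = pureState fun p => x p.2.2 * y (p.1, p.2.1)}

/-- The real bilinear pairing `⟨x, y⟩ = Tr (x yᵗ)` on self-adjoint matrices (this trace is a real
number, see `coe_pairing`). -/
noncomputable def pairing : Herm →ₗ[ℝ] Herm →ₗ[ℝ] ℝ :=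
  LinearMap.mk₂ ℝ
    (fun x y => (Matrix.trace ((x : Matrix Idx Idx ℂ) * (y : Matrix Idx Idx ℂ).transpose)).re)
    (fun x x' y => by simp [add_mul])
    (fun c x y => by simp)
    (fun x y y' => by simp [mul_add])
    (fun c x y => by simp)

theorem coe_pairing (x y : Herm) :
    (pairing x y : ℂ) =
      Matrix.trace ((x : Matrix Idx Idx ℂ) * (y : Matrix Idx Idx ℂ).transpose) := by
  apply Complex.conj_eq_iff_re.mp
  have hx : (x : Matrix Idx Idx ℂ).conjTranspose = x := x.2
  have hy : (y : Matrix Idx Idx ℂ).conjTranspose = y := y.2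
  have hy' : (y : Matrix Idx Idx ℂ).transpose.conjTranspose =
      (y : Matrix Idx Idx ℂ).transpose := by
    conv_rhs => rw [← hy]
    rfl
  rw [starRingEnd_apply, ← Matrix.trace_conjTranspose, Matrix.conjTranspose_mul, hx, hy',
    Matrix.trace_mul_comm]

/-- The dual cone `σ° = {W | ⟨ϱ, W⟩ ≥ 0 for every ϱ ∈ σ}`. -/
noncomputable def dualCone (σ : PointedCone ℝ Herm) : PointedCone ℝ Herm :=
  PointedCone.dual pairing (σ : Set Herm)

/-- The real vector space of all `X`-shaped self-adjoint matrices: all entries vanish except for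
the diagonal ones and the anti-diagonal ones. In the lexicographic order of the basis, the
anti-diagonal entry in the row `(i, j, k)` is in the column of the flipped bits. -/
def XSpace : Submodule ℝ Herm where
  carrier := {W | ∀ p q : Idx, q ≠ p → q ≠ (p.1.rev, p.2.1.rev, p.2.2.rev) →
    (W : Matrix Idx Idx ℂ) p q = 0}
  zero_mem' := by intro p q _ _; simp
  add_mem' := by
    intro a b ha hb p q h h'
    simp [ha p q h h', hb p q h h']
  smul_mem' := by
    intro c a ha p q h h'
    simp [ha p q h h']

/-- `σ°_X = σ° ∩ X`. -/
noncomputable def dualConeX (σ : PointedCone ℝ Herm) : PointedCone ℝ Herm :=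
  dualCone σ ⊓ (XSpace : PointedCone ℝ Herm)

/-- `Q = [α ∧ (β ∨ γ)] ∨ [β ∧ (γ ∨ α)] ∨ [γ ∧ (α ∨ β)]`. In the lattice of convex cones the meet
is the intersection and the join is the convex hull, i.e. the sum, of the cones. -/
noncomputable def Q : PointedCone ℝ Herm :=
  (alpha ⊓ (beta ⊔ gamma)) ⊔ (beta ⊓ (gamma ⊔ alpha)) ⊔ (gamma ⊓ (alpha ⊔ beta))

end ThreeQubit

open ThreeQubit

/-!
The formula for `Q°` is duality for sums and intersections of cones. The dual of a sum is the
intersection of the duals, and the dual of an intersection is the sum of the duals, with no closure,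
as soon as the two cones have a common order unit (`dual_inf`, from the M. Riesz extension theorem).
The identity is an order unit for the cone of fully separable states, which lies in `α`, `β` and `γ`
(`exists_smul_one_add_mem_fullySep`): the pure product states span, and each of them can be
completed by product states to a multiple of the identity.

For the distributive laws, the bits are added modulo `2`, and `u = 111`, so that the anti-diagonal
entry in the row `p` is in the column `p + u`. For a self-adjoint `W` let
`r p = √(W p p * W (p + u) (p + u))` and `m p = |W p (p + u)|`. If `W` is in `α°`, then its diagonal
is nonnegative and `m p + m (p + 100) ≤ r p + r (p + 100)` for all `p` (`balanced_of_mem`), and for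
`X`-shaped `W` these conditions are also sufficient (`mem_dualCone_of_balanced`). Likewise for `β`
with `010` and for `γ` with `001`. Since `r` is superadditive and `m` is subadditive, membership of
`W` in `α°` and in the constituents `β° ∨ (γ° ∧ α°)` and `γ° ∨ (α° ∧ β°)` of `Q°` gives linear
inequalities between the values of `r` and `m`. These suffice to split `r` and `m` into a part with
the inequalities of `α` and `β` and a remainder with those of `α` and `γ` (`splits_of_balanced`):
if some `m p` exceeds `r p`, the excess of the class with the least `r p - m p` is distributed over
the other three classes, and this determines the whole splitting. Scaling the entries of `W` accordingly (`rescale`) gives the decomposition.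
-/

namespace ThreeQubit

/-! ### Duals of intersections of cones -/

/-- The dual of an intersection is the sum of the duals, without taking a closure, when the two cones
have a common order unit `e`. The proof extends the functional `(x, x) ↦ p x W` from the diagonal of
`E × E` to one that is nonnegative on `σ × τ`. -/
theorem dual_inf {E F : Type*} [AddCommGroup E] [Module ℝ E] [AddCommGroup F] [Module ℝ F]
    (p : E →ₗ[ℝ] F →ₗ[ℝ] ℝ) (hp : Function.Surjective p.flip) (σ τ : PointedCone ℝ E) (e : E)
    (heσ : e ∈ σ) (heτ : e ∈ τ) (hσ : ∀ x, ∃ t : ℝ, t • e + x ∈ σ)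
    (hτ : ∀ x, ∃ t : ℝ, t • e + x ∈ τ) :
    PointedCone.dual p (σ ⊓ τ : PointedCone ℝ E) = PointedCone.dual p σ ⊔ PointedCone.dual p τ := by
  apply le_antisymm
  · intro W hW
    let f : E × E →ₗ.[ℝ] ℝ :=
      ⟨LinearMap.range (LinearMap.prod (LinearMap.id : E →ₗ[ℝ] E) LinearMap.id),
        (p.flip W ∘ₗ LinearMap.fst ℝ E E) ∘ₗ Submodule.subtype _⟩
    obtain ⟨g, hgf, hg⟩ := riesz_extension (Submodule.prod σ τ : PointedCone ℝ (E × E)) f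
      (by
        rintro ⟨_, x, rfl⟩ hx
        exact hW ⟨hx.1, hx.2⟩)
      (by
        rintro ⟨x, y⟩
        obtain ⟨t, ht⟩ := hσ x
        obtain ⟨s, hs⟩ := hτ y
        refine ⟨⟨_, max t s • e, rfl⟩, ?_, ?_⟩
        · have := σ.add_mem (PointedCone.smul_mem σ (sub_nonneg.2 (le_max_left t s)) heσ) ht
          rw [← add_assoc, ← add_smul, sub_add_cancel] at this
          exact this
        · have := τ.add_mem (PointedCone.smul_mem τ (sub_nonneg.2 (le_max_right t s)) heτ) hs
          rw [← add_assoc, ← add_smul, sub_add_cancel] at this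
          exact this)
    obtain ⟨W₁, h₁⟩ := hp (g ∘ₗ LinearMap.inl ℝ E E)
    have h₁' : ∀ x, p x W₁ = g (x, 0) := fun x => LinearMap.congr_fun h₁ x
    have hsum : ∀ x, p x W = g (x, x) := fun x => (hgf ⟨_, x, rfl⟩).symm
    refine Submodule.mem_sup.2 ⟨W₁, fun x hx => ?_, W - W₁, fun x hx => ?_, by abel⟩
    · rw [h₁']
      exact hg _ ⟨hx, τ.zero_mem⟩
    · rw [map_sub, h₁', hsum, ← map_sub]
      exact hg _ ⟨by simp, by simpa using hx⟩
  · exact sup_le (PointedCone.dual_anti fun x hx => hx.1) (PointedCone.dual_anti fun x hx => hx.2)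

theorem dual_sup_eq_inf {E F : Type*} [AddCommGroup E] [Module ℝ E] [AddCommGroup F] [Module ℝ F]
    (p : E →ₗ[ℝ] F →ₗ[ℝ] ℝ) (σ τ : PointedCone ℝ E) :
    PointedCone.dual p (σ ⊔ τ : PointedCone ℝ E) = PointedCone.dual p σ ⊓ PointedCone.dual p τ := by
  rw [PointedCone.dual_sup, PointedCone.dual_union]

/-! ### The pairing -/

theorem pairing_apply (x y : Herm) :
    pairing x y = ∑ p, ∑ q, ((x : Matrix Idx Idx ℂ) p q * (y : Matrix Idx Idx ℂ) p q).re := by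
  change (Matrix.trace ((x : Matrix Idx Idx ℂ) * (y : Matrix Idx Idx ℂ).transpose)).re = _
  simp only [Matrix.trace, Matrix.diag, Matrix.mul_apply, Matrix.transpose_apply, Complex.re_sum]

instance : FiniteDimensional ℝ Herm :=
  inferInstanceAs (FiniteDimensional ℝ (selfAdjoint.submodule ℝ (Matrix Idx Idx ℂ)))

/-- Every linear functional is a pairing with a self-adjoint matrix, because
`⟨yᵗ, y⟩ = ∑ |y p q|²` makes the pairing nondegenerate. -/
theorem pairing_flip_surjective : Function.Surjective pairing.flip := by
  have hinj : Function.Injective pairing.flip := by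
    rw [injective_iff_map_eq_zero]
    intro y hy
    have h := LinearMap.congr_fun hy
      ⟨(y : Matrix Idx Idx ℂ).transpose, by
        have h := y.2
        rw [selfAdjoint.mem_iff, Matrix.star_eq_conjTranspose] at h ⊢
        conv_rhs => rw [← h]
        rfl⟩
    replace h := (pairing_apply _ _).symm.trans h
    have hterm : ∀ p q : Idx, ((y : Matrix Idx Idx ℂ).transpose p q *
        (y : Matrix Idx Idx ℂ) p q).re = Complex.normSq ((y : Matrix Idx Idx ℂ) p q) := by
      intro p q
      have : (y : Matrix Idx Idx ℂ) q p = star ((y : Matrix Idx Idx ℂ) p q) :=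
        (congrFun (congrFun y.2 q) p).symm
      rw [Matrix.transpose_apply, this, Complex.star_def, ← Complex.normSq_eq_conj_mul_self,
        Complex.ofReal_re]
    have h0 : ∑ p, ∑ q, Complex.normSq ((y : Matrix Idx Idx ℂ) p q) = 0 :=
      (Finset.sum_congr rfl fun p _ => Finset.sum_congr rfl fun q _ =>
        (hterm p q).symm).trans h
    ext p q
    have h' := (Finset.sum_eq_zero_iff_of_nonneg
      fun p _ => Finset.sum_nonneg fun q _ => Complex.normSq_nonneg _).1 h0 p (Finset.mem_univ _)
    exact Complex.normSq_eq_zero.1 ((Finset.sum_eq_zero_iff_of_nonneg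
      fun q _ => Complex.normSq_nonneg _).1 h' q (Finset.mem_univ _))
  refine (LinearMap.injective_iff_surjective_of_finrank_eq_finrank ?_).1 hinj
  exact (Subspace.dual_finrank_eq (K := ℝ) (V := Herm)).symm

theorem pairing_pureState (ψ : Idx → ℂ) (U : Herm) :
    pairing (pureState ψ) U =
      ∑ p, ∑ q, (ψ p * star (ψ q) * (U : Matrix Idx Idx ℂ) p q).re := by
  rw [pairing_apply]; rfl

/-! ### Fully separable states -/

/-- The un-normalized pure product state of three qubit vectors. -/
def productState (x y z : Fin 2 → ℂ) : Herm := pureState fun p => x p.1 * (y p.2.1 * z p.2.2)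

/-- The convex cone of fully separable states. -/
noncomputable def fullySep : PointedCone ℝ Herm :=
  PointedCone.hull ℝ {ρ | ∃ x y z, ρ = productState x y z}

theorem fullySep_le_alpha : fullySep ≤ alpha := by
  refine Submodule.span_le.2 ?_
  rintro _ ⟨x, y, z, rfl⟩
  exact Submodule.subset_span ⟨x, fun q => y q.1 * z q.2, rfl⟩

theorem fullySep_le_beta : fullySep ≤ beta := by
  refine Submodule.span_le.2 ?_
  rintro _ ⟨x, y, z, rfl⟩
  refine Submodule.subset_span ⟨y, fun q => z q.1 * x q.2, ?_⟩
  unfold productState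
  congr 1; funext p; ring

theorem fullySep_le_gamma : fullySep ≤ gamma := by
  refine Submodule.span_le.2 ?_
  rintro _ ⟨x, y, z, rfl⟩
  refine Submodule.subset_span ⟨z, fun q => x q.1 * y q.2, ?_⟩
  unfold productState
  congr 1; funext p; ring

/-- A vector orthogonal to `x`, of the same norm. -/
def perp (x : Fin 2 → ℂ) : Fin 2 → ℂ := ![-star (x 1), star (x 0)]

theorem add_perp (x : Fin 2 → ℂ) (i j : Fin 2) :
    x i * star (x j) + perp x i * star (perp x j) =
      if i = j then ((Complex.normSq (x 0) + Complex.normSq (x 1) : ℝ) : ℂ) else 0 := by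
  fin_cases i <;> fin_cases j <;>
    simp [perp, Complex.normSq_eq_conj_mul_self] <;> ring

theorem productState_apply (x y z : Fin 2 → ℂ) (p q : Idx) :
    (productState x y z : Matrix Idx Idx ℂ) p q =
      (x p.1 * star (x q.1)) * ((y p.2.1 * star (y q.2.1)) * (z p.2.2 * star (z q.2.2))) := by
  change x p.1 * (y p.2.1 * z p.2.2) * star (x q.1 * (y q.2.1 * z q.2.2)) = _
  simp only [star_mul]; ring

/-- A product state can be completed by product states to a multiple of the identity. -/
theorem sum_productState_perp (x y z : Fin 2 → ℂ) :
    productState x y z + (productState x y (perp z) + productState x (perp y) z +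
      productState x (perp y) (perp z) + productState (perp x) y z +
      productState (perp x) y (perp z) + productState (perp x) (perp y) z +
      productState (perp x) (perp y) (perp z)) =
      ((Complex.normSq (x 0) + Complex.normSq (x 1)) *
        ((Complex.normSq (y 0) + Complex.normSq (y 1)) *
          (Complex.normSq (z 0) + Complex.normSq (z 1)))) • (1 : Herm) := by
  ext p q
  simp only [AddSubgroup.coe_add, Matrix.add_apply, productState_apply]
  calc _ = (x p.1 * star (x q.1) + perp x p.1 * star (perp x q.1)) *
        ((y p.2.1 * star (y q.2.1) + perp y p.2.1 * star (perp y q.2.1)) *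
          (z p.2.2 * star (z q.2.2) + perp z p.2.2 * star (perp z q.2.2))) := by ring
    _ = _ := by
      rw [add_perp, add_perp, add_perp]
      simp only [selfAdjoint.val_smul, selfAdjoint.val_one, Matrix.smul_apply, Matrix.one_apply,
        Complex.real_smul]
      obtain ⟨p1, p2, p3⟩ := p
      obtain ⟨q1, q2, q3⟩ := q
      by_cases h1 : p1 = q1 <;> by_cases h2 : p2 = q2 <;> by_cases h3 : p3 = q3 <;>
        simp [h1, h2, h3]

theorem productState_mem (x y z : Fin 2 → ℂ) : productState x y z ∈ fullySep :=
  Submodule.subset_span ⟨x, y, z, rfl⟩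

theorem one_mem_fullySep : (1 : Herm) ∈ fullySep := by
  have h := sum_productState_perp ![1, 0] ![1, 0] ![1, 0]
  simp at h
  rw [← h]
  repeat' apply Submodule.add_mem
  all_goals exact productState_mem _ _ _

/-- The elements `x` for which both `x` and `-x` are dominated by a multiple of the identity in
the order of the fully separable cone. -/
noncomputable def boundedPart : Submodule ℝ Herm where
  carrier := {x | ∃ t : ℝ, t • 1 + x ∈ fullySep ∧ t • 1 - x ∈ fullySep}
  zero_mem' := ⟨0, by simp, by simp⟩
  add_mem' := by
    rintro x y ⟨s, hs, hs'⟩ ⟨t, ht, ht'⟩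
    refine ⟨s + t, ?_, ?_⟩
    · convert fullySep.add_mem hs ht using 1
      module
    · convert fullySep.add_mem hs' ht' using 1
      module
  smul_mem' := by
    rintro c x ⟨t, ht, ht'⟩
    refine ⟨|c| * t, ?_, ?_⟩
    · rcases le_total 0 c with hc | hc
      · convert PointedCone.smul_mem fullySep hc ht using 1
        rw [abs_of_nonneg hc]; module
      · convert PointedCone.smul_mem fullySep (neg_nonneg.2 hc) ht' using 1
        rw [abs_of_nonpos hc]; module
    · rcases le_total 0 c with hc | hc
      · convert PointedCone.smul_mem fullySep hc ht' using 1
        rw [abs_of_nonneg hc]; module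
      · convert PointedCone.smul_mem fullySep (neg_nonneg.2 hc) ht using 1
        rw [abs_of_nonpos hc]; module

theorem productState_mem_boundedPart (x y z : Fin 2 → ℂ) : productState x y z ∈ boundedPart := by
  refine ⟨((Complex.normSq (x 0) + Complex.normSq (x 1)) *
        ((Complex.normSq (y 0) + Complex.normSq (y 1)) *
          (Complex.normSq (z 0) + Complex.normSq (z 1)))), ?_, ?_⟩
  · refine fullySep.add_mem (PointedCone.smul_mem _ ?_ one_mem_fullySep) (productState_mem x y z)
    have := Complex.normSq_nonneg
    exact mul_nonneg (add_nonneg (this _) (this _))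
      (mul_nonneg (add_nonneg (this _) (this _)) (add_nonneg (this _) (this _)))
  · rw [← sum_productState_perp, add_sub_cancel_left]
    repeat' apply Submodule.add_mem
    all_goals exact productState_mem _ _ _

/-- Polarization: matrix units are complex combinations of pure states. -/
theorem exists_matrixUnit_eq_sum (i j : Fin 2) : ∃ (c : Fin 4 → ℂ) (x : Fin 4 → Fin 2 → ℂ),
    ∀ k l, ∑ m, c m * (x m k * star (x m l)) = if k = i ∧ l = j then 1 else 0 := by
  refine ⟨fun m => (-Complex.I) ^ (m : ℕ) / 4,
    fun m k => (if k = i then 1 else 0) * Complex.I ^ (m : ℕ) + if k = j then 1 else 0, ?_⟩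
  intro k l
  have h2 : Complex.I ^ 2 = -1 := Complex.I_sq
  have h3 : Complex.I ^ 3 = -Complex.I := Complex.I_pow_three
  have h4 : ∀ a b c d : ℂ, ∑ m : Fin 4, (-Complex.I) ^ (m : ℕ) / 4 *
      ((a * Complex.I ^ (m : ℕ) + b) * star (c * Complex.I ^ (m : ℕ) + d)) = a * star d := by
    intro a b c d
    simp only [Fin.sum_univ_four, Complex.star_def, map_add, map_mul, map_pow, Complex.conj_I]
    simp
    ring_nf
    simp only [h2, h3, show Complex.I ^ 4 = 1 from Complex.I_pow_four,
      show Complex.I ^ 6 = -1 by rw [show 6 = 4 + 2 from rfl, pow_add, Complex.I_pow_four, h2]; ring,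
      show Complex.I ^ 7 = -Complex.I by
        rw [show 7 = 4 + 3 from rfl, pow_add, Complex.I_pow_four, h3]; ring]
    ring_nf
  rw [h4]
  by_cases hk : k = i <;> by_cases hl : l = j <;> simp [hk, hl]

/-- The pure product states span all complex matrices, so their real span contains the real part
`W` of such a combination. -/
theorem boundedPart_eq_top : boundedPart = ⊤ := by
  choose c x hx using exists_matrixUnit_eq_sum
  refine eq_top_iff.2 fun W _ => ?_
  have hW : (W : Matrix Idx Idx ℂ) = ∑ p : Idx, ∑ q : Idx, ∑ m₁, ∑ m₂, ∑ m₃,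
      ((W : Matrix Idx Idx ℂ) p q * (c p.1 q.1 m₁ * (c p.2.1 q.2.1 m₂ * c p.2.2 q.2.2 m₃))) •
        (productState (x p.1 q.1 m₁) (x p.2.1 q.2.1 m₂) (x p.2.2 q.2.2 m₃) :
          Matrix Idx Idx ℂ) := by
    ext k l
    simp only [Matrix.sum_apply, Matrix.smul_apply, productState_apply, smul_eq_mul]
    have key : ∀ p q : Idx, (∑ m₁, ∑ m₂, ∑ m₃, (W : Matrix Idx Idx ℂ) p q *
        (c p.1 q.1 m₁ * (c p.2.1 q.2.1 m₂ * c p.2.2 q.2.2 m₃)) *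
        (x p.1 q.1 m₁ k.1 * star (x p.1 q.1 m₁ l.1) *
          (x p.2.1 q.2.1 m₂ k.2.1 * star (x p.2.1 q.2.1 m₂ l.2.1) *
            (x p.2.2 q.2.2 m₃ k.2.2 * star (x p.2.2 q.2.2 m₃ l.2.2))))) =
        if k = p then (if l = q then (W : Matrix Idx Idx ℂ) p q else 0) else 0 := by
      intro p q
      calc _ = (W : Matrix Idx Idx ℂ) p q *
            ((∑ m, c p.1 q.1 m * (x p.1 q.1 m k.1 * star (x p.1 q.1 m l.1))) *
            ((∑ m, c p.2.1 q.2.1 m * (x p.2.1 q.2.1 m k.2.1 * star (x p.2.1 q.2.1 m l.2.1))) *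
            (∑ m, c p.2.2 q.2.2 m * (x p.2.2 q.2.2 m k.2.2 * star (x p.2.2 q.2.2 m l.2.2))))) := by
            rw [Finset.sum_mul, Finset.mul_sum]
            refine Finset.sum_congr rfl fun _ _ => ?_
            rw [Finset.sum_mul, Finset.mul_sum, Finset.mul_sum]
            refine Finset.sum_congr rfl fun _ _ => ?_
            rw [Finset.mul_sum, Finset.mul_sum, Finset.mul_sum]
            refine Finset.sum_congr rfl fun _ _ => ?_
            ring
        _ = _ := by
            rw [hx, hx, hx]
            obtain ⟨p1, p2, p3⟩ := p
            obtain ⟨q1, q2, q3⟩ := q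
            obtain ⟨k1, k2, k3⟩ := k
            obtain ⟨l1, l2, l3⟩ := l
            simp only [Prod.mk.injEq, ← ite_and, mul_ite, mul_one, mul_zero]
            exact if_congr (by tauto) rfl rfl
    simp only [key]
    simp
  have hre : W = realPart (W : Matrix Idx Idx ℂ) := by
    ext1
    exact (W.2.coe_realPart).symm
  rw [hre, hW]
  simp only [map_sum, realPart_smul]
  refine Submodule.sum_mem _ fun p _ => Submodule.sum_mem _ fun q _ => Submodule.sum_mem _
    fun m₁ _ => Submodule.sum_mem _ fun m₂ _ => Submodule.sum_mem _ fun m₃ _ => ?_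
  rw [(productState _ _ _).2.imaginaryPart, smul_zero, sub_zero]
  refine Submodule.smul_mem _ _ ?_
  convert productState_mem_boundedPart (x p.1 q.1 m₁) (x p.2.1 q.2.1 m₂) (x p.2.2 q.2.2 m₃)
  ext1
  exact (productState _ _ _).2.coe_realPart

theorem exists_smul_one_add_mem_fullySep (x : Herm) : ∃ t : ℝ, t • 1 + x ∈ fullySep := by
  have : x ∈ boundedPart := boundedPart_eq_top ▸ Submodule.mem_top
  obtain ⟨t, ht, -⟩ := this
  exact ⟨t, ht⟩

theorem dualCone_inf {σ τ : PointedCone ℝ Herm} (hσ : fullySep ≤ σ) (hτ : fullySep ≤ τ) :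
    dualCone (σ ⊓ τ) = dualCone σ ⊔ dualCone τ :=
  dual_inf pairing pairing_flip_surjective σ τ 1 (hσ one_mem_fullySep) (hτ one_mem_fullySep)
    (fun x => (exists_smul_one_add_mem_fullySep x).imp fun _ h => hσ h)
    (fun x => (exists_smul_one_add_mem_fullySep x).imp fun _ h => hτ h)

theorem dualCone_sup (σ τ : PointedCone ℝ Herm) :
    dualCone (σ ⊔ τ) = dualCone σ ⊓ dualCone τ :=
  dual_sup_eq_inf pairing σ τ

theorem dualCone_Q : dualCone Q =
    (dualCone alpha ⊔ (dualCone beta ⊓ dualCone gamma)) ⊓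
      (dualCone beta ⊔ (dualCone gamma ⊓ dualCone alpha)) ⊓
      (dualCone gamma ⊔ (dualCone alpha ⊓ dualCone beta)) := by
  rw [Q, dualCone_sup, dualCone_sup,
    dualCone_inf fullySep_le_alpha (fullySep_le_beta.trans le_sup_left),
    dualCone_inf fullySep_le_beta (fullySep_le_gamma.trans le_sup_left),
    dualCone_inf fullySep_le_gamma (fullySep_le_alpha.trans le_sup_left),
    dualCone_sup, dualCone_sup, dualCone_sup]

/-! ### The splitting of diagonal and anti-diagonal weights -/

/-- The numerical core. The indices `1, 2, 3, 4` stand for the classes of `000`, `001`, `010`, `100`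
modulo flipping all bits; `r` holds the geometric means of the diagonal entries and `m` the moduli
of the anti-diagonal ones. A pair `(r, m)` with the inequalities for `α` splits into a part `(s, n)`
with those for `α` and `β`, and a remainder with those for `α` and `γ`. The class `1` is assumed to
have the smallest `r - m`. -/
theorem exists_split_of_min {r₁ r₂ r₃ r₄ m₁ m₂ m₃ m₄ : ℝ}
    (hr₁ : 0 ≤ r₁) (hr₂ : 0 ≤ r₂) (hr₃ : 0 ≤ r₃) (hr₄ : 0 ≤ r₄)
    (hm₁ : 0 ≤ m₁) (hm₂ : 0 ≤ m₂) (hm₃ : 0 ≤ m₃) (hm₄ : 0 ≤ m₄)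
    (h14 : m₁ + m₄ ≤ r₁ + r₄) (h23 : m₂ + m₃ ≤ r₂ + r₃)
    (h1 : m₁ ≤ r₁ + r₂ + r₃) (h12 : m₁ + m₂ ≤ r₁ + r₂ + 2 * r₃)
    (h13 : m₁ + m₃ ≤ r₁ + r₃ + 2 * r₂)
    (d2 : r₁ - m₁ ≤ r₂ - m₂) (d3 : r₁ - m₁ ≤ r₃ - m₃) :
    ∃ s₁ s₂ s₃ s₄ n₁ n₂ n₃ n₄ : ℝ,
      ((0 ≤ s₁ ∧ s₁ ≤ r₁) ∧ (0 ≤ s₂ ∧ s₂ ≤ r₂) ∧ (0 ≤ s₃ ∧ s₃ ≤ r₃) ∧ (0 ≤ s₄ ∧ s₄ ≤ r₄)) ∧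
      ((0 ≤ n₁ ∧ n₁ ≤ m₁) ∧ (0 ≤ n₂ ∧ n₂ ≤ m₂) ∧ (0 ≤ n₃ ∧ n₃ ≤ m₃) ∧ (0 ≤ n₄ ∧ n₄ ≤ m₄)) ∧
      (n₁ + n₄ ≤ s₁ + s₄ ∧ n₂ + n₃ ≤ s₂ + s₃) ∧
      (n₁ + n₃ ≤ s₁ + s₃ ∧ n₂ + n₄ ≤ s₂ + s₄) ∧
      ((m₁ - n₁) + (m₄ - n₄) ≤ (r₁ - s₁) + (r₄ - s₄) ∧
        (m₂ - n₂) + (m₃ - n₃) ≤ (r₂ - s₂) + (r₃ - s₃)) ∧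
      ((m₁ - n₁) + (m₂ - n₂) ≤ (r₁ - s₁) + (r₂ - s₂) ∧
        (m₃ - n₃) + (m₄ - n₄) ≤ (r₃ - s₃) + (r₄ - s₄)) := by
  rcases le_total m₁ r₁ with h | h
  · refine ⟨r₁, r₂, r₃, r₄, m₁, m₂, m₃, m₄, ?_⟩
    simp only [le_refl, sub_self, add_zero, and_true, true_and, *]
    refine ⟨?_, ?_⟩ <;> linarith
  -- The excess `m₁ - r₁` is shared out: the amount `Y` is paid from `r₂` and `r₄` in the remainder,
  -- and `m₁ - r₁ - Y` from `r₃` and `r₄` in the part `(s, n)`.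
  · obtain ⟨Y, hY0, hY1, hY2, hY3, hY4, hY5⟩ : ∃ Y : ℝ, 0 ≤ Y ∧ Y ≤ m₁ - r₁ ∧ Y ≤ r₂ ∧
        m₁ - r₁ - Y ≤ r₃ ∧ Y - (m₁ - r₁ - Y) ≤ r₂ - m₂ ∧ (m₁ - r₁ - Y) - Y ≤ r₃ - m₃ := by
      refine ⟨max 0 (max (m₁ - r₁ - r₃) ((m₁ - r₁ - (r₃ - m₃)) / 2)), le_max_left _ _, ?_⟩
      have a1 := le_max_left 0 (max (m₁ - r₁ - r₃) ((m₁ - r₁ - (r₃ - m₃)) / 2))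
      have a2 := le_max_right 0 (max (m₁ - r₁ - r₃) ((m₁ - r₁ - (r₃ - m₃)) / 2))
      have a3 := le_max_left (m₁ - r₁ - r₃) ((m₁ - r₁ - (r₃ - m₃)) / 2)
      have a4 := le_max_right (m₁ - r₁ - r₃) ((m₁ - r₁ - (r₃ - m₃)) / 2)
      have b : ∀ t : ℝ, 0 ≤ t → m₁ - r₁ - r₃ ≤ t → (m₁ - r₁ - (r₃ - m₃)) / 2 ≤ t →
          max 0 (max (m₁ - r₁ - r₃) ((m₁ - r₁ - (r₃ - m₃)) / 2)) ≤ t :=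
        fun t u v w => max_le u (max_le v w)
      refine ⟨b _ ?_ ?_ ?_, b _ ?_ ?_ ?_, ?_, ?_, ?_⟩
      · linarith
      · linarith
      · linarith
      · linarith
      · linarith
      · linarith
      · linarith
      · have := b ((r₂ - m₂ + (m₁ - r₁)) / 2) (by linarith) (by linarith) (by linarith)
        linarith
      · linarith
    -- The `r₃` spent on the first part can at the same time cover the amount `x` of `m₂`.
    obtain ⟨x, c1, c2, c3, hx⟩ : ∃ x : ℝ, x ≤ m₁ - r₁ - Y ∧ x ≤ m₂ ∧ 0 ≤ x ∧
        (x = m₁ - r₁ - Y ∨ x = m₂) :=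
      ⟨_, min_le_left _ _, min_le_right _ _, le_min (by linarith) hm₂, min_choice _ _⟩
    refine ⟨r₁, 0, m₁ - r₁ - Y, m₁ - r₁ - Y, m₁ - Y, x, 0, 0,
      ⟨⟨?_, ?_⟩, ⟨?_, ?_⟩, ⟨?_, ?_⟩, ?_, ?_⟩, ⟨⟨?_, ?_⟩, ⟨?_, ?_⟩, ⟨?_, ?_⟩, ?_, ?_⟩, ⟨?_, ?_⟩,
      ⟨?_, ?_⟩, ⟨?_, ?_⟩, ?_, ?_⟩ <;> rcases hx with hx | hx <;> linarith

/-- The function on basis indices that takes the values `x₁`, `x₂`, `x₃`, `x₄` at `000`, `001`,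
`010`, `100` and is invariant under flipping all three bits. -/
def classFun (x₁ x₂ x₃ x₄ : ℝ) (q : Idx) : ℝ :=
  if q.1 = q.2.1 then (if q.1 = q.2.2 then x₁ else x₂) else (if q.1 = q.2.2 then x₃ else x₄)

/-- Invariance under flipping all three bits; `Idx` carries the group structure of `(ℤ/2)³`, and
adding `(1, 1, 1)` flips every bit. -/
def FlipInvariant (f : Idx → ℝ) : Prop := ∀ p, f (p + (1, 1, 1)) = f p

/-- The inequalities that tie the diagonal weights `r` of an `X`-shaped witness to its
anti-diagonal moduli `m`, for the bipartition which separates the party whose bit is flipped by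
adding `v`. -/
def Balanced (v : Idx) (r m : Idx → ℝ) : Prop := ∀ p, m p + m (p + v) ≤ r p + r (p + v)

theorem FlipInvariant.eq_classFun {f : Idx → ℝ} (hf : FlipInvariant f) :
    f = classFun (f (0, 0, 0)) (f (0, 0, 1)) (f (0, 1, 0)) (f (1, 0, 0)) := by
  have h1 : f (1, 1, 1) = f (0, 0, 0) := hf (0, 0, 0)
  have h2 : f (1, 1, 0) = f (0, 0, 1) := hf (0, 0, 1)
  have h3 : f (1, 0, 1) = f (0, 1, 0) := hf (0, 1, 0)
  have h4 : f (0, 1, 1) = f (1, 0, 0) := hf (1, 0, 0)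
  funext ⟨i, j, k⟩
  fin_cases i <;> fin_cases j <;> fin_cases k <;> simp [classFun, h1, h2, h3, h4]

theorem flipInvariant_classFun (x₁ x₂ x₃ x₄ : ℝ) : FlipInvariant (classFun x₁ x₂ x₃ x₄) := by
  rintro ⟨i, j, k⟩
  simp [classFun]

theorem balanced_classFun_iff {s₁ s₂ s₃ s₄ n₁ n₂ n₃ n₄ : ℝ} :
    (Balanced (1, 0, 0) (classFun s₁ s₂ s₃ s₄) (classFun n₁ n₂ n₃ n₄) ↔
      n₁ + n₄ ≤ s₁ + s₄ ∧ n₂ + n₃ ≤ s₂ + s₃) ∧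
    (Balanced (0, 1, 0) (classFun s₁ s₂ s₃ s₄) (classFun n₁ n₂ n₃ n₄) ↔
      n₁ + n₃ ≤ s₁ + s₃ ∧ n₂ + n₄ ≤ s₂ + s₄) ∧
    (Balanced (0, 0, 1) (classFun s₁ s₂ s₃ s₄) (classFun n₁ n₂ n₃ n₄) ↔
      n₁ + n₂ ≤ s₁ + s₂ ∧ n₃ + n₄ ≤ s₃ + s₄) := by
  simp only [Balanced, Prod.forall, Fin.forall_fin_two, classFun]
  simp
  refine ⟨?_, ?_, ?_⟩ <;> constructor <;> intro h <;> (try constructor) <;>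
    simp only [add_comm] at * <;> tauto

theorem exists_mul_eq {s r : ℝ} (h0 : 0 ≤ s) (h : s ≤ r) : ∃ l : ℝ, 0 ≤ l ∧ l ≤ 1 ∧ s = l * r := by
  rcases (h0.trans h).eq_or_lt with h' | h'
  · exact ⟨0, le_rfl, zero_le_one, by linarith⟩
  · exact ⟨s / r, div_nonneg h0 h'.le, (div_le_one h').2 h, (div_mul_cancel₀ s h'.ne').symm⟩

/-- The weights `(r, m)` split, by factors `l` and `k` between `0` and `1`, into a part balanced for
`a` and `b` and a remainder balanced for `a` and `c`. -/
def Splits (a b c : Idx) (r m : Idx → ℝ) : Prop :=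
  ∃ l k : Idx → ℝ, (∀ p, 0 ≤ l p ∧ l p ≤ 1) ∧ (∀ p, 0 ≤ k p ∧ k p ≤ 1) ∧
    FlipInvariant l ∧ FlipInvariant k ∧
    Balanced a (fun p => l p * r p) (fun p => k p * m p) ∧
    Balanced b (fun p => l p * r p) (fun p => k p * m p) ∧
    Balanced a (fun p => (1 - l p) * r p) (fun p => (1 - k p) * m p) ∧
    Balanced c (fun p => (1 - l p) * r p) (fun p => (1 - k p) * m p)

theorem splits_of_min {r m : Idx → ℝ} (hr : ∀ p, 0 ≤ r p) (hm : ∀ p, 0 ≤ m p)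
    (hrf : FlipInvariant r) (hmf : FlipInvariant m)
    (ha : Balanced (1, 0, 0) r m)
    (h1 : ∀ p, m p ≤ r p + r (p + (0, 0, 1)) + r (p + (0, 1, 0)))
    (h12 : ∀ p, m p + m (p + (0, 0, 1)) ≤ r p + r (p + (0, 0, 1)) + 2 * r (p + (0, 1, 0)))
    (h13 : ∀ p, m p + m (p + (0, 1, 0)) ≤ r p + r (p + (0, 1, 0)) + 2 * r (p + (0, 0, 1)))
    (hmin : ∀ q, r 0 - m 0 ≤ r q - m q) :
    Splits (1, 0, 0) (0, 1, 0) (0, 0, 1) r m := by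
  have ha' := ha
  rw [hrf.eq_classFun, hmf.eq_classFun, balanced_classFun_iff.1] at ha'
  obtain ⟨s₁, s₂, s₃, s₄, n₁, n₂, n₃, n₄, ⟨⟨a1, a2⟩, ⟨a3, a4⟩, ⟨a5, a6⟩, a7, a8⟩,
    ⟨⟨b1, b2⟩, ⟨b3, b4⟩, ⟨b5, b6⟩, b7, b8⟩, hA, hB, hA', hC⟩ :=
    exists_split_of_min (hr (0, 0, 0)) (hr (0, 0, 1)) (hr (0, 1, 0)) (hr (1, 0, 0))
      (hm (0, 0, 0)) (hm (0, 0, 1)) (hm (0, 1, 0)) (hm (1, 0, 0)) ha'.1 ha'.2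
      (h1 (0, 0, 0)) (h12 (0, 0, 0)) (h13 (0, 0, 0)) (hmin _) (hmin _)
  obtain ⟨l₁, c1, d1, rfl⟩ := exists_mul_eq a1 a2
  obtain ⟨l₂, c2, d2, rfl⟩ := exists_mul_eq a3 a4
  obtain ⟨l₃, c3, d3, rfl⟩ := exists_mul_eq a5 a6
  obtain ⟨l₄, c4, d4, rfl⟩ := exists_mul_eq a7 a8
  obtain ⟨k₁, e1, f1, rfl⟩ := exists_mul_eq b1 b2
  obtain ⟨k₂, e2, f2, rfl⟩ := exists_mul_eq b3 b4
  obtain ⟨k₃, e3, f3, rfl⟩ := exists_mul_eq b5 b6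
  obtain ⟨k₄, e4, f4, rfl⟩ := exists_mul_eq b7 b8
  have hmul : ∀ {f : Idx → ℝ} (_ : FlipInvariant f) (x₁ x₂ x₃ x₄ : ℝ),
      (fun p => classFun x₁ x₂ x₃ x₄ p * f p) = classFun (x₁ * f (0, 0, 0)) (x₂ * f (0, 0, 1))
        (x₃ * f (0, 1, 0)) (x₄ * f (1, 0, 0)) := by
    intro f hf x₁ x₂ x₃ x₄
    funext p
    conv_lhs => rw [hf.eq_classFun]
    unfold classFun
    split_ifs <;> rfl
  have hmul' : ∀ {f : Idx → ℝ} (_ : FlipInvariant f) (x₁ x₂ x₃ x₄ : ℝ),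
      (fun p => (1 - classFun x₁ x₂ x₃ x₄ p) * f p) = classFun (f (0, 0, 0) - x₁ * f (0, 0, 0))
        (f (0, 0, 1) - x₂ * f (0, 0, 1)) (f (0, 1, 0) - x₃ * f (0, 1, 0))
        (f (1, 0, 0) - x₄ * f (1, 0, 0)) := by
    intro f hf x₁ x₂ x₃ x₄
    funext p
    conv_lhs => rw [hf.eq_classFun]
    unfold classFun
    split_ifs <;> ring
  refine ⟨classFun l₁ l₂ l₃ l₄, classFun k₁ k₂ k₃ k₄, fun p => ?_, fun p => ?_,
    flipInvariant_classFun _ _ _ _, flipInvariant_classFun _ _ _ _, ?_, ?_, ?_, ?_⟩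
  · unfold classFun
    split_ifs <;> constructor <;> assumption
  · unfold classFun
    split_ifs <;> constructor <;> assumption
  · rw [hmul hrf, hmul hmf, balanced_classFun_iff.1]
    exact hA
  · rw [hmul hrf, hmul hmf, balanced_classFun_iff.2.1]
    exact hB
  · rw [hmul' hrf, hmul' hmf, balanced_classFun_iff.1]
    exact hA'
  · rw [hmul' hrf, hmul' hmf, balanced_classFun_iff.2.2]
    exact hC

theorem idx_add_self (p : Idx) : p + p = 0 := by revert p; decide

/-- The splitting for any ordering of the three parties, encoded by `σ`: translating the group `Idx`
moves the minimum of `r - m` to `000`. -/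
theorem splits_of_balanced {r m : Idx → ℝ} (σ : Idx ≃+ Idx) (hσ : σ (1, 1, 1) = (1, 1, 1))
    (hr : ∀ p, 0 ≤ r p) (hm : ∀ p, 0 ≤ m p)
    (hrf : FlipInvariant r) (hmf : FlipInvariant m)
    (ha : Balanced (σ (1, 0, 0)) r m)
    (h1 : ∀ p, m p ≤ r p + r (p + σ (0, 0, 1)) + r (p + σ (0, 1, 0)))
    (h12 : ∀ p, m p + m (p + σ (0, 0, 1)) ≤ r p + r (p + σ (0, 0, 1)) + 2 * r (p + σ (0, 1, 0)))
    (h13 : ∀ p, m p + m (p + σ (0, 1, 0)) ≤ r p + r (p + σ (0, 1, 0)) + 2 * r (p + σ (0, 0, 1))) :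
    Splits (σ (1, 0, 0)) (σ (0, 1, 0)) (σ (0, 0, 1)) r m := by
  obtain ⟨p₀, hp₀⟩ := Finite.exists_min fun p => r p - m p
  obtain ⟨l, k, hl, hk, hlf, hkf, hA, hB, hA', hC⟩ :=
    splits_of_min (r := fun q => r (p₀ + σ q)) (m := fun q => m (p₀ + σ q))
      (fun _ => hr _) (fun _ => hm _)
      (fun q => by simp only [map_add, hσ, ← add_assoc]; exact hrf _)
      (fun q => by simp only [map_add, hσ, ← add_assoc]; exact hmf _)
      (fun q => by simp only [map_add, ← add_assoc]; exact ha _)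
      (fun q => by simp only [map_add, ← add_assoc]; exact h1 _)
      (fun q => by simp only [map_add, ← add_assoc]; exact h12 _)
      (fun q => by simp only [map_add, ← add_assoc]; exact h13 _)
      (fun q => by simp only [map_zero, add_zero]; exact hp₀ _)
  have hback : ∀ p, p₀ + σ (σ.symm (p + p₀)) = p := fun p => by
    rw [σ.apply_symm_apply, add_left_comm, idx_add_self, add_zero]
  have hshift : ∀ p v, σ.symm (p + σ v + p₀) = σ.symm (p + p₀) + v := fun p v => by
    rw [add_right_comm, map_add, σ.symm_apply_apply]
  have hbal : ∀ {v : Idx} {f g : Idx → ℝ},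
      Balanced v (fun q => f q * r (p₀ + σ q)) (fun q => g q * m (p₀ + σ q)) →
      Balanced (σ v) (fun p => f (σ.symm (p + p₀)) * r p) (fun p => g (σ.symm (p + p₀)) * m p) := by
    intro v f g h p
    have := h (σ.symm (p + p₀))
    simp only [map_add σ, ← add_assoc, hback] at this
    simpa only [hshift] using this
  refine ⟨fun p => l (σ.symm (p + p₀)), fun p => k (σ.symm (p + p₀)), fun _ => hl _, fun _ => hk _,
    fun p => ?_, fun p => ?_, hbal hA, hbal hB, hbal (f := fun q => 1 - l q) (g := fun q => 1 - k q)
    hA', hbal (f := fun q => 1 - l q) (g := fun q => 1 - k q) hC⟩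
  · have := hshift p (1, 1, 1)
    rw [hσ] at this
    simp only [this]
    exact hlf _
  · have := hshift p (1, 1, 1)
    rw [hσ] at this
    simp only [this]
    exact hkf _

/-! ### Entries of bi-separability witnesses -/

/-- The diagonal entry of `U` at `p`. -/
def diagEntry (U : Herm) (p : Idx) : ℝ := ((U : Matrix Idx Idx ℂ) p p).re

/-- The modulus of the anti-diagonal entry of `U` in the row `p`. -/
noncomputable def antiNorm (U : Herm) (p : Idx) : ℝ := ‖(U : Matrix Idx Idx ℂ) p (p + (1, 1, 1))‖

/-- The geometric mean of the two diagonal entries that share a `2 × 2` block of an `X`-shaped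
matrix. -/
noncomputable def diagMean (U : Herm) (p : Idx) : ℝ :=
  √(diagEntry U p * diagEntry U (p + (1, 1, 1)))

/-- The cone of states separable for the bipartition that `e` describes: the single party is the
first coordinate after the relabelling `e` of the bits. -/
noncomputable def sepCone (e : Idx ≃+ Idx) : PointedCone ℝ Herm :=
  PointedCone.hull ℝ {ρ | ∃ (x : Fin 2 → ℂ) (y : Fin 2 × Fin 2 → ℂ),
    ρ = pureState fun p => x (e p).1 * y (e p).2}

theorem mem_dualCone_sepCone {e : Idx ≃+ Idx} {U : Herm} :
    U ∈ dualCone (sepCone e) ↔ ∀ (x : Fin 2 → ℂ) (y : Fin 2 × Fin 2 → ℂ),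
      0 ≤ pairing (pureState fun p => x (e p).1 * y (e p).2) U := by
  rw [dualCone, sepCone, PointedCone.dual_hull, PointedCone.mem_dual]
  constructor
  · intro h x y
    exact h ⟨x, y, rfl⟩
  · rintro h _ ⟨x, y, rfl⟩
    exact h x y

theorem add_flip_flip (p : Idx) : p + (1, 1, 1) + (1, 1, 1) = p := by
  rw [add_assoc, idx_add_self, add_zero]

theorem star_apply (U : Herm) (p q : Idx) :
    star ((U : Matrix Idx Idx ℂ) p q) = (U : Matrix Idx Idx ℂ) q p :=
  congrFun (congrFun U.2 q) p

theorem coe_diagEntry (U : Herm) (p : Idx) :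
    (diagEntry U p : ℂ) = (U : Matrix Idx Idx ℂ) p p :=
  Complex.conj_eq_iff_re.1 (star_apply U p p)

theorem antiNorm_nonneg (U : Herm) (p : Idx) : 0 ≤ antiNorm U p := norm_nonneg _

theorem diagMean_nonneg (U : Herm) (p : Idx) : 0 ≤ diagMean U p := Real.sqrt_nonneg _

theorem flipInvariant_antiNorm (U : Herm) : FlipInvariant (antiNorm U) := fun p => by
  unfold antiNorm
  rw [add_flip_flip, ← star_apply, norm_star]

theorem flipInvariant_diagMean (U : Herm) : FlipInvariant (diagMean U) := fun p => by
  unfold diagMean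
  rw [add_flip_flip, mul_comm]

theorem antiNorm_add_le (U V : Herm) (p : Idx) :
    antiNorm (U + V) p ≤ antiNorm U p + antiNorm V p := norm_add_le _ _

theorem sqrt_mul_add_sqrt_mul_le {a b c d : ℝ} (ha : 0 ≤ a) (hb : 0 ≤ b) (hc : 0 ≤ c)
    (hd : 0 ≤ d) : √(a * b) + √(c * d) ≤ √((a + c) * (b + d)) := by
  apply Real.le_sqrt_of_sq_le
  rw [Real.sqrt_mul ha, Real.sqrt_mul hc]
  nlinarith [sq_nonneg (√a * √d - √c * √b), Real.sq_sqrt ha, Real.sq_sqrt hb, Real.sq_sqrt hc,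
    Real.sq_sqrt hd, mul_pow (√a) (√b) 2, mul_pow (√c) (√d) 2, mul_pow (√a) (√d) 2,
    mul_pow (√c) (√b) 2]

theorem diagMean_add_le {U V : Herm} (hU : ∀ p, 0 ≤ diagEntry U p) (hV : ∀ p, 0 ≤ diagEntry V p)
    (p : Idx) : diagMean U p + diagMean V p ≤ diagMean (U + V) p :=
  sqrt_mul_add_sqrt_mul_le (hU _) (hU _) (hV _) (hV _)

theorem diagEntry_nonneg {e : Idx ≃+ Idx} {U : Herm} (hU : U ∈ dualCone (sepCone e)) (p : Idx) :
    0 ≤ diagEntry U p := by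
  have h := mem_dualCone_sepCone.1 hU (Pi.single (e p).1 1) (Pi.single (e p).2 1)
  have hψ : (fun q => (Pi.single (e p).1 1 : Fin 2 → ℂ) (e q).1 *
      (Pi.single (e p).2 1 : Fin 2 × Fin 2 → ℂ) (e q).2) = Pi.single p 1 := by
    funext q
    simp only [Pi.single_apply, mul_ite, mul_one, mul_zero, ← ite_and]
    refine if_congr ?_ rfl rfl
    rw [and_comm, ← Prod.ext_iff, e.injective.eq_iff]
  rw [hψ, pairing_pureState, Fintype.sum_eq_single p, Fintype.sum_eq_single p] at h
  · simpa [diagEntry] using h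
  · intro q hq
    simp [hq]
  · intro q hq
    simp [hq]

theorem exists_phase (z : ℂ) : ∃ ζ : ℂ, ‖ζ‖ = 1 ∧ ζ * z = -‖z‖ := by
  rcases eq_or_ne z 0 with rfl | hz
  · exact ⟨1, by simp, by simp⟩
  · have hn : (‖z‖ : ℂ) ≠ 0 := by simpa using hz
    refine ⟨-(star z / ‖z‖), by simp [hz], ?_⟩
    have := Complex.conj_mul' z
    field_simp
    rw [Complex.star_def, this]

/-- Two phases can be prescribed independently for `c * d` and `d * star c`. -/
theorem exists_phases (z w : ℂ) : ∃ c d : ℂ, ‖c‖ = 1 ∧ ‖d‖ = 1 ∧ c * d * z = -‖z‖ ∧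
    d * star c * w = -‖w‖ := by
  obtain ⟨ζ, hζ, hz⟩ := exists_phase z
  obtain ⟨η, hη, hw⟩ := exists_phase w
  obtain ⟨d, hd⟩ := IsAlgClosed.exists_pow_nat_eq (ζ * η) (n := 2) (by norm_num)
  have hdn : ‖d‖ = 1 := by
    have : ‖d‖ ^ 2 = 1 := by rw [← norm_pow, hd, norm_mul, hζ, hη, one_mul]
    exact (pow_eq_one_iff_of_nonneg (norm_nonneg _) two_ne_zero).1 this
  have hdd : d * star d = 1 := by
    rw [Complex.star_def, Complex.mul_conj', hdn]; norm_num
  have hζζ : ζ * star ζ = 1 := by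
    rw [Complex.star_def, Complex.mul_conj', hζ]; norm_num
  refine ⟨ζ * star d, d, by simp [hζ, hdn], hdn, ?_, ?_⟩
  · rw [← hz]
    linear_combination ζ * z * hdd
  · rw [← hw, star_mul, star_star]
    linear_combination star ζ * w * hd + η * w * hζζ

/-- The infimum of `P * a + b / P` over `P > 0` is `2 * √(a * b)`. It need not be attained when `a` or
`b` vanishes, hence the limit `ε → 0`. -/
theorem le_sqrt_add_sqrt_of_forall {a b c d w : ℝ} (ha : 0 ≤ a) (hb : 0 ≤ b) (hc : 0 ≤ c)
    (hd : 0 ≤ d)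
    (h : ∀ P R : ℝ, 0 < P → 0 < R → 2 * w ≤ P * a + b / P + (R * c + d / R)) :
    w ≤ √(a * b) + √(c * d) := by
  have key : ∀ ε : ℝ, 0 < ε → w ≤ √((a + ε) * (b + ε)) + √((c + ε) * (d + ε)) := by
    intro ε hε
    have aux : ∀ {x y : ℝ}, 0 ≤ x → 0 ≤ y → ∃ P, 0 < P ∧
        P * x + y / P ≤ 2 * √((x + ε) * (y + ε)) := by
      intro x y hx hy
      have hx' : 0 < √(x + ε) := Real.sqrt_pos.2 (by linarith)
      have hy' : 0 < √(y + ε) := Real.sqrt_pos.2 (by linarith)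
      refine ⟨√(y + ε) / √(x + ε), div_pos hy' hx', ?_⟩
      have hP := div_pos hy' hx'
      have h1 : √(y + ε) / √(x + ε) * x ≤ √(y + ε) / √(x + ε) * (x + ε) :=
        mul_le_mul_of_nonneg_left (by linarith) hP.le
      have h2 : y / (√(y + ε) / √(x + ε)) ≤ (y + ε) / (√(y + ε) / √(x + ε)) :=
        div_le_div_of_nonneg_right (by linarith) hP.le
      have h3 : √(y + ε) / √(x + ε) * (x + ε) = √(x + ε) * √(y + ε) := by
        nth_rewrite 2 [← Real.mul_self_sqrt (show 0 ≤ x + ε by linarith)]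
        field_simp
      have h4 : (y + ε) / (√(y + ε) / √(x + ε)) = √(x + ε) * √(y + ε) := by
        nth_rewrite 1 [← Real.mul_self_sqrt (show 0 ≤ y + ε by linarith)]
        field_simp
      rw [Real.sqrt_mul (by linarith)]
      linarith
    obtain ⟨P, hP, hP'⟩ := aux ha hb
    obtain ⟨R, hR, hR'⟩ := aux hc hd
    linarith [h P R hP hR]
  have hcont : Continuous fun ε : ℝ => √((a + ε) * (b + ε)) + √((c + ε) * (d + ε)) := by
    fun_prop
  have hlim : Filter.Tendsto (fun ε : ℝ => √((a + ε) * (b + ε)) + √((c + ε) * (d + ε)))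
      (nhdsWithin 0 (Set.Ioi 0)) (nhds (√(a * b) + √(c * d))) := by
    have := hcont.tendsto 0
    simp only [add_zero] at this
    exact this.mono_left nhdsWithin_le_nhds
  exact ge_of_tendsto hlim (Filter.eventually_of_mem self_mem_nhdsWithin key)

/-- Test vectors supported on four basis indices. Flipping the signs of the second coordinates of
both tensor factors and averaging kills all the entries of `U` but the diagonal and anti-diagonal
ones. -/
theorem expectation_nonneg_of_mem (U : Herm) {e : Idx ≃+ Idx} (hU : U ∈ dualCone (sepCone e)) (p : Idx)
    (X Y : ℂ) :
    0 ≤ ‖X * Y‖ ^ 2 * diagEntry U p + ‖Y‖ ^ 2 * diagEntry U (p + e.symm (1, 0, 0)) +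
      ‖X‖ ^ 2 * diagEntry U (p + e.symm (0, 1, 1)) + diagEntry U (p + e.symm (1, 1, 1)) +
      2 * (X * Y * (U : Matrix Idx Idx ℂ) p (p + e.symm (1, 1, 1))).re +
      2 * (Y * star X * (U : Matrix Idx Idx ℂ) (p + e.symm (1, 0, 0))
        (p + e.symm (0, 1, 1))).re := by
  have h : ∀ ε : ℂ, 0 ≤ ∑ t : Idx, ∑ t' : Idx,
      ((![X, ε] t.1 * ![![Y, 0], ![0, ε]] t.2.1 t.2.2) *
        star (![X, ε] t'.1 * ![![Y, 0], ![0, ε]] t'.2.1 t'.2.2) *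
        (U : Matrix Idx Idx ℂ) (p + e.symm t) (p + e.symm t')).re := by
    intro ε
    have h := mem_dualCone_sepCone.1 hU (fun i => ![X, ε] ((e p).1 + i))
      (fun j => ![![Y, 0], ![0, ε]] ((e p).2.1 + j.1) ((e p).2.2 + j.2))
    rw [pairing_pureState] at h
    have hsum : ∀ f : Idx → ℝ, ∑ q, f q = ∑ t, f (p + e.symm t) := fun f =>
      (Equiv.sum_comp (e.symm.toEquiv.trans (Equiv.addLeft p)) f).symm
    rw [hsum, Finset.sum_congr rfl fun t _ => hsum _] at h
    have hs : ∀ a b : Fin 2, a + (a + b) = b := by decide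
    simpa only [map_add, AddEquiv.apply_symm_apply, Prod.fst_add, Prod.snd_add, hs] using h
  -- The four indices in the support are `p + e.symm t` with `t` among `000`, `100`, `011`, `111`.
  have h1 := h 1
  have h2 := h (-1)
  have hz : p + e.symm (0, 0, 0) = p := by
    rw [show ((0, 0, 0) : Idx) = 0 from rfl, map_zero, add_zero]
  have e1 := coe_diagEntry U p
  have e2 := coe_diagEntry U (p + e.symm (1, 0, 0))
  have e3 := coe_diagEntry U (p + e.symm (0, 1, 1))
  have e4 := coe_diagEntry U (p + e.symm (1, 1, 1))
  have e5 := star_apply U p (p + e.symm (1, 1, 1))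
  have e6 := star_apply U (p + e.symm (1, 0, 0)) (p + e.symm (0, 1, 1))
  simp [Fintype.sum_prod_type, Fin.sum_univ_two, hz, ← e1, ← e2, ← e3, ← e4, ← e5, ← e6] at h1 h2
  simp only [← Complex.normSq_eq_norm_sq, Complex.normSq_apply]
  simp
  linarith

/-- The inequalities satisfied by any witness, `X`-shaped or not. -/
theorem balanced_of_mem {e : Idx ≃+ Idx} (he : e.symm (1, 1, 1) = (1, 1, 1)) {U : Herm}
    (hU : U ∈ dualCone (sepCone e)) :
    Balanced (e.symm (1, 0, 0)) (diagMean U) (antiNorm U) := by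
  intro p
  have hv : p + e.symm (0, 1, 1) = p + e.symm (1, 0, 0) + (1, 1, 1) := by
    rw [add_assoc, ← he, ← map_add]
    rfl
  refine le_sqrt_add_sqrt_of_forall (diagEntry_nonneg hU _) (diagEntry_nonneg hU _)
    (diagEntry_nonneg hU _) (diagEntry_nonneg hU _) fun P R hP hR => ?_
  obtain ⟨c, d, hc, hd, hz, hw⟩ := exists_phases
    ((U : Matrix Idx Idx ℂ) p (p + (1, 1, 1)))
    ((U : Matrix Idx Idx ℂ) (p + e.symm (1, 0, 0)) (p + e.symm (1, 0, 0) + (1, 1, 1)))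
  -- Moduli with `|X Y| = P` and `|Y|² = P R`, so that division by `P` gives the claim.
  have h := expectation_nonneg_of_mem U hU p ((√(P / R) : ℝ) * c) ((√(P * R) : ℝ) * d)
  rw [hv, he] at h
  have hPR : √(P / R) * √(P * R) = P := by
    rw [← Real.sqrt_mul (div_nonneg hP.le hR.le), show P / R * (P * R) = P * P by field_simp,
      Real.sqrt_mul_self hP.le]
  have hPR' : ((√(P / R) : ℝ) : ℂ) * (√(P * R) : ℝ) = P := by exact_mod_cast hPR
  have hXY : ‖(√(P / R) : ℝ) * c * ((√(P * R) : ℝ) * d)‖ = P := by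
    rw [norm_mul, norm_mul, norm_mul, hc, hd, Complex.norm_of_nonneg (Real.sqrt_nonneg _),
      Complex.norm_of_nonneg (Real.sqrt_nonneg _), mul_one, mul_one, hPR]
  have hX : ‖(√(P / R) : ℝ) * c‖ ^ 2 = P / R := by
    rw [norm_mul, hc, Complex.norm_of_nonneg (Real.sqrt_nonneg _), mul_one,
      Real.sq_sqrt (div_nonneg hP.le hR.le)]
  have hY : ‖(√(P * R) : ℝ) * d‖ ^ 2 = P * R := by
    rw [norm_mul, hd, Complex.norm_of_nonneg (Real.sqrt_nonneg _), mul_one,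
      Real.sq_sqrt (mul_nonneg hP.le hR.le)]
  have h1 : (√(P / R) : ℝ) * c * ((√(P * R) : ℝ) * d) *
      (U : Matrix Idx Idx ℂ) p (p + (1, 1, 1)) = ((-(P * antiNorm U p) : ℝ) : ℂ) := by
    push_cast
    unfold antiNorm
    linear_combination (c * d * (U : Matrix Idx Idx ℂ) p (p + (1, 1, 1))) * hPR' + (P : ℂ) * hz
  have h2 : (√(P * R) : ℝ) * d * star ((√(P / R) : ℝ) * c) *
      (U : Matrix Idx Idx ℂ) (p + e.symm (1, 0, 0)) (p + e.symm (1, 0, 0) + (1, 1, 1)) =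
        ((-(P * antiNorm U (p + e.symm (1, 0, 0))) : ℝ) : ℂ) := by
    have : star ((√(P / R) : ℝ) : ℂ) = (√(P / R) : ℝ) := Complex.conj_ofReal _
    rw [star_mul, this]
    push_cast
    unfold antiNorm
    linear_combination (d * star c * (U : Matrix Idx Idx ℂ) (p + e.symm (1, 0, 0))
      (p + e.symm (1, 0, 0) + (1, 1, 1))) * hPR' + (P : ℂ) * hw
  rw [hXY, hX, hY, h1, h2, Complex.ofReal_re, Complex.ofReal_re] at h
  refine le_of_mul_le_mul_left ?_ hP
  have e1 : P * (P * diagEntry U p + diagEntry U (p + (1, 1, 1)) / P +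
      (R * diagEntry U (p + e.symm (1, 0, 0)) +
        diagEntry U (p + e.symm (1, 0, 0) + (1, 1, 1)) / R)) =
      P ^ 2 * diagEntry U p + P * R * diagEntry U (p + e.symm (1, 0, 0)) +
        P / R * diagEntry U (p + e.symm (1, 0, 0) + (1, 1, 1)) + diagEntry U (p + (1, 1, 1)) := by
    field_simp
    ring
  rw [e1]
  linarith

theorem mem_XSpace {W : Herm} : W ∈ XSpace ↔
    ∀ p q : Idx, q ≠ p → q ≠ p + (1, 1, 1) → (W : Matrix Idx Idx ℂ) p q = 0 := by
  have h : ∀ p : Idx, (p.1.rev, p.2.1.rev, p.2.2.rev) = p + (1, 1, 1) := by decide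
  change (∀ p q : Idx, q ≠ p → q ≠ (p.1.rev, p.2.1.rev, p.2.2.rev) → _) ↔ _
  simp only [h]

theorem ne_add_flip (p : Idx) : p ≠ p + (1, 1, 1) := by revert p; decide

theorem pairing_pureState_of_mem_XSpace {W : Herm} (hW : W ∈ XSpace) (ψ : Idx → ℂ) :
    pairing (pureState ψ) W = ∑ p, (‖ψ p‖ ^ 2 * diagEntry W p +
      (ψ p * star (ψ (p + (1, 1, 1))) * (W : Matrix Idx Idx ℂ) p (p + (1, 1, 1))).re) := by
  rw [pairing_pureState]
  refine Finset.sum_congr rfl fun p _ => ?_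
  rw [Fintype.sum_eq_add p (p + (1, 1, 1)) (ne_add_flip p)]
  · congr 1
    rw [← coe_diagEntry, Complex.star_def, Complex.mul_conj', ← Complex.ofReal_pow,
      ← Complex.ofReal_mul, Complex.ofReal_re]
  · rintro q ⟨h1, h2⟩
    rw [mem_XSpace.1 hW p q h1 h2, mul_zero, Complex.zero_re]

theorem sum_add_right (f : Idx → ℝ) (v : Idx) : ∑ p, f (p + v) = ∑ p, f p :=
  Equiv.sum_comp (Equiv.addRight v) f

/-- For `X`-shaped matrices the inequalities are sufficient. -/
theorem mem_dualCone_of_balanced {e : Idx ≃+ Idx} (he : e.symm (1, 1, 1) = (1, 1, 1)) {W : Herm}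
    (hW : W ∈ XSpace) (hd : ∀ p, 0 ≤ diagEntry W p)
    (hb : Balanced (e.symm (1, 0, 0)) (diagMean W) (antiNorm W)) :
    W ∈ dualCone (sepCone e) := by
  rw [mem_dualCone_sepCone]
  intro x y
  rw [pairing_pureState_of_mem_XSpace hW]
  set ψ : Idx → ℂ := fun p => x (e p).1 * y (e p).2 with hψ
  set κ : Idx → ℝ := fun p => ‖ψ p‖ * ‖ψ (p + (1, 1, 1))‖ with hκ
  have hκ0 : ∀ p, 0 ≤ κ p := fun p => by positivity
  have heu : e (1, 1, 1) = (1, 1, 1) := by rw [← he, e.apply_symm_apply, he]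
  -- The product structure makes `κ` invariant under flipping the bit of the single party.
  have hκv : ∀ p, κ (p + e.symm (1, 0, 0)) = κ p := by
    intro p
    have h2 : ∀ a : Fin 2, a + 1 + 1 = a := by decide
    simp only [hκ, hψ, map_add, e.apply_symm_apply, heu, Prod.fst_add, Prod.snd_add, norm_mul,
      add_zero, h2, Prod.mk_zero_zero]
    ring
  have h1 : ∀ p, κ p * diagMean W p - κ p * antiNorm W p ≤
      (‖ψ p‖ ^ 2 * diagEntry W p + ‖ψ (p + (1, 1, 1))‖ ^ 2 * diagEntry W (p + (1, 1, 1))) / 2 +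
      (ψ p * star (ψ (p + (1, 1, 1))) * (W : Matrix Idx Idx ℂ) p (p + (1, 1, 1))).re := by
    intro p
    have ha : -(κ p * antiNorm W p) ≤
        (ψ p * star (ψ (p + (1, 1, 1))) * (W : Matrix Idx Idx ℂ) p (p + (1, 1, 1))).re := by
      have := (abs_le.1 (Complex.abs_re_le_norm
        (ψ p * star (ψ (p + (1, 1, 1))) * (W : Matrix Idx Idx ℂ) p (p + (1, 1, 1))))).1
      rwa [norm_mul, norm_mul, norm_star] at this
    have hg : κ p * diagMean W p ≤ (‖ψ p‖ ^ 2 * diagEntry W p +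
        ‖ψ (p + (1, 1, 1))‖ ^ 2 * diagEntry W (p + (1, 1, 1))) / 2 := by
      have s1 := Real.sq_sqrt (hd p)
      have s2 := Real.sq_sqrt (hd (p + (1, 1, 1)))
      simp only [hκ, diagMean]
      rw [Real.sqrt_mul (hd p)]
      nth_rewrite 2 [← s1]
      nth_rewrite 2 [← s2]
      nlinarith [sq_nonneg (‖ψ p‖ * √(diagEntry W p) -
        ‖ψ (p + (1, 1, 1))‖ * √(diagEntry W (p + (1, 1, 1))))]
    linarith
  have h2 : 0 ≤ ∑ p, (κ p * diagMean W p - κ p * antiNorm W p) := by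
    have h3 : 0 ≤ ∑ p, ((κ p * diagMean W p - κ p * antiNorm W p) +
        (κ (p + e.symm (1, 0, 0)) * diagMean W (p + e.symm (1, 0, 0)) -
          κ (p + e.symm (1, 0, 0)) * antiNorm W (p + e.symm (1, 0, 0)))) := by
      refine Finset.sum_nonneg fun p _ => ?_
      rw [hκv]
      nlinarith [mul_le_mul_of_nonneg_left (hb p) (hκ0 p)]
    rw [Finset.sum_add_distrib,
      sum_add_right (fun p => κ p * diagMean W p - κ p * antiNorm W p)] at h3
    linarith
  refine h2.trans ((Finset.sum_le_sum fun p _ => h1 p).trans_eq ?_)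
  rw [Finset.sum_add_distrib, Finset.sum_add_distrib, ← Finset.sum_div, Finset.sum_add_distrib,
    sum_add_right (fun p => ‖ψ p‖ ^ 2 * diagEntry W p)]
  ring

/-! ### The distributive law -/

/-- Rescaling of the diagonal entries of `W` by `l` and of the anti-diagonal ones by `k`. -/
def rescale (l k : Idx → ℝ) (hk : FlipInvariant k) (W : Herm) : Herm :=
  ⟨Matrix.of fun p q => if q = p then (l p : ℂ) * (W : Matrix Idx Idx ℂ) p q else
    if q = p + (1, 1, 1) then (k p : ℂ) * (W : Matrix Idx Idx ℂ) p q else 0, by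
    rw [selfAdjoint.mem_iff]
    ext p q
    rw [Matrix.star_apply, Matrix.of_apply, Matrix.of_apply]
    by_cases h : q = p
    · subst h
      simp only [if_true, star_mul, star_apply]
      rw [mul_comm]
      exact congrArg (· * _) (Complex.conj_ofReal _)
    · by_cases h' : q = p + (1, 1, 1)
      · subst h'
        simp only [add_flip_flip, ne_add_flip p, (ne_add_flip p).symm, if_true, if_false, star_mul,
          star_apply, hk p]
        rw [mul_comm]
        exact congrArg (· * _) (Complex.conj_ofReal _)
      · have h2 : p ≠ q + (1, 1, 1) := fun h2 => h' (by rw [h2, add_flip_flip])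
        simp [h, h', h2, Ne.symm h]⟩

theorem rescale_mem_XSpace {l k : Idx → ℝ} (hk : FlipInvariant k) (W : Herm) :
    rescale l k hk W ∈ XSpace := by
  refine mem_XSpace.2 fun p q h h' => ?_
  simp [rescale, h, h']

theorem diagEntry_rescale {l k : Idx → ℝ} (hk : FlipInvariant k) (W : Herm) (p : Idx) :
    diagEntry (rescale l k hk W) p = l p * diagEntry W p := by
  simp [rescale, diagEntry]

theorem diagMean_rescale {l k : Idx → ℝ} (hk : FlipInvariant k) (W : Herm) (hl : FlipInvariant l)
    (hl0 : ∀ p, 0 ≤ l p) : diagMean (rescale l k hk W) = fun p => l p * diagMean W p := by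
  funext p
  unfold diagMean
  rw [diagEntry_rescale, diagEntry_rescale, hl, mul_mul_mul_comm,
    Real.sqrt_mul (mul_self_nonneg _), Real.sqrt_mul_self (hl0 p)]

theorem antiNorm_rescale {l k : Idx → ℝ} (hk : FlipInvariant k) (W : Herm)
    (hk0 : ∀ p, 0 ≤ k p) : antiNorm (rescale l k hk W) = fun p => k p * antiNorm W p := by
  funext p
  simp [rescale, antiNorm, abs_of_nonneg (hk0 p)]

theorem rescale_add_rescale {l k : Idx → ℝ} (hk : FlipInvariant k)
    (hk' : FlipInvariant fun p => 1 - k p) {W : Herm} (hW : W ∈ XSpace) :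
    rescale l k hk W + rescale (fun p => 1 - l p) (fun p => 1 - k p) hk' W = W := by
  ext p q
  rw [AddSubgroup.coe_add, Matrix.add_apply]
  simp only [rescale, Matrix.of_apply]
  split_ifs with h h'
  · push_cast; ring
  · push_cast; ring
  · rw [mem_XSpace.1 hW p q h h', add_zero]

theorem rescale_mem_dualCone {e : Idx ≃+ Idx} (he : e.symm (1, 1, 1) = (1, 1, 1))
    {l k : Idx → ℝ} (hl : FlipInvariant l) (hk : FlipInvariant k) (hl0 : ∀ p, 0 ≤ l p)
    (hk0 : ∀ p, 0 ≤ k p) {W : Herm} (hd : ∀ p, 0 ≤ diagEntry W p)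
    (hb : Balanced (e.symm (1, 0, 0)) (fun p => l p * diagMean W p)
      (fun p => k p * antiNorm W p)) :
    rescale l k hk W ∈ dualCone (sepCone e) := by
  refine mem_dualCone_of_balanced he (rescale_mem_XSpace hk W) (fun p => ?_) ?_
  · rw [diagEntry_rescale]
    exact mul_nonneg (hl0 p) (hd p)
  · rwa [diagMean_rescale hk W hl hl0, antiNorm_rescale hk W hk0]

/-- The nontrivial inclusion of the distributive law. The decompositions of `W` that `hW₂` and `hW₃`
provide need not be `X`-shaped; they only enter through the inequalities between their entries. -/
theorem exists_decomposition {e₁ e₂ e₃ : Idx ≃+ Idx} (he₁ : e₁.symm (1, 1, 1) = (1, 1, 1))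
    (he₂ : e₂.symm (1, 1, 1) = (1, 1, 1)) (he₃ : e₃.symm (1, 1, 1) = (1, 1, 1))
    (h₂ : e₂.symm (1, 0, 0) = e₁.symm (0, 1, 0)) (h₃ : e₃.symm (1, 0, 0) = e₁.symm (0, 0, 1))
    {W : Herm} (hW : W ∈ XSpace) (hW₁ : W ∈ dualCone (sepCone e₁))
    (hW₂ : W ∈ dualCone (sepCone e₂) ⊔ (dualCone (sepCone e₃) ⊓ dualCone (sepCone e₁)))
    (hW₃ : W ∈ dualCone (sepCone e₃) ⊔ (dualCone (sepCone e₁) ⊓ dualCone (sepCone e₂))) :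
    ∃ S T : Herm, S + T = W ∧ S ∈ XSpace ∧ T ∈ XSpace ∧
      S ∈ dualCone (sepCone e₁) ∧ S ∈ dualCone (sepCone e₂) ∧
      T ∈ dualCone (sepCone e₁) ∧ T ∈ dualCone (sepCone e₃) := by
  obtain ⟨U, hU, V, ⟨hV₃, hV₁⟩, hUV⟩ := Submodule.mem_sup.1 hW₂
  obtain ⟨U', hU', V', ⟨hV'₁, hV'₂⟩, hUV'⟩ := Submodule.mem_sup.1 hW₃
  have bU := balanced_of_mem he₂ hU
  have bV₃ := balanced_of_mem he₃ hV₃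
  have bV₁ := balanced_of_mem he₁ hV₁
  have bU' := balanced_of_mem he₃ hU'
  have bV'₁ := balanced_of_mem he₁ hV'₁
  have bV'₂ := balanced_of_mem he₂ hV'₂
  rw [h₂] at bU bV'₂
  rw [h₃] at bU' bV₃
  have r1 : ∀ p, diagMean U p + diagMean V p ≤ diagMean W p := fun p =>
    hUV ▸ diagMean_add_le (diagEntry_nonneg hU) (diagEntry_nonneg hV₁) p
  have m1 : ∀ p, antiNorm W p ≤ antiNorm U p + antiNorm V p := fun p =>
    hUV ▸ antiNorm_add_le U V p
  have r2 : ∀ p, diagMean U' p + diagMean V' p ≤ diagMean W p := fun p =>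
    hUV' ▸ diagMean_add_le (diagEntry_nonneg hU') (diagEntry_nonneg hV'₁) p
  have m2 : ∀ p, antiNorm W p ≤ antiNorm U' p + antiNorm V' p := fun p =>
    hUV' ▸ antiNorm_add_le U' V' p
  have n1 := diagMean_nonneg U
  have n2 := diagMean_nonneg V
  have n3 := antiNorm_nonneg U
  have n4 := antiNorm_nonneg V
  have n1' := diagMean_nonneg U'
  have n2' := diagMean_nonneg V'
  have n3' := antiNorm_nonneg U'
  have n4' := antiNorm_nonneg V'
  -- The sum of two party flips is the third one followed by flipping all the bits.
  have s1 : ∀ p, p + e₁.symm (0, 1, 0) + e₁.symm (1, 0, 0) =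
      p + e₁.symm (0, 0, 1) + (1, 1, 1) := fun p => by
    rw [← he₁, add_assoc, add_assoc, ← map_add, ← map_add]; rfl
  have s2 : ∀ p, p + e₁.symm (0, 0, 1) + e₁.symm (1, 0, 0) =
      p + e₁.symm (0, 1, 0) + (1, 1, 1) := fun p => by
    rw [← he₁, add_assoc, add_assoc, ← map_add, ← map_add]; rfl
  obtain ⟨l, k, hl, hk, hlf, hkf, hA, hB, hA', hC⟩ := splits_of_balanced e₁.symm he₁
    (diagMean_nonneg W) (antiNorm_nonneg W) (flipInvariant_diagMean W) (flipInvariant_antiNorm W)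
    (balanced_of_mem he₁ hW₁)
    (fun p => by
      linarith [bU p, bV₃ p, m1 p, r1 p, r1 (p + e₁.symm (0, 0, 1)), r1 (p + e₁.symm (0, 1, 0)),
        n1 (p + e₁.symm (0, 0, 1)), n2 (p + e₁.symm (0, 1, 0)), n3 (p + e₁.symm (0, 1, 0)),
        n4 (p + e₁.symm (0, 0, 1))])
    (fun p => by
      have hb := bV'₁ (p + e₁.symm (0, 0, 1))
      rw [s2, flipInvariant_antiNorm, flipInvariant_diagMean] at hb
      linarith [bU' p, bV'₂ p, m2 p, m2 (p + e₁.symm (0, 0, 1)), r2 p,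
        r2 (p + e₁.symm (0, 0, 1)), r2 (p + e₁.symm (0, 1, 0)), n1' (p + e₁.symm (0, 1, 0)),
        n4' (p + e₁.symm (0, 1, 0))])
    (fun p => by
      have hb := bV₁ (p + e₁.symm (0, 1, 0))
      rw [s1, flipInvariant_antiNorm, flipInvariant_diagMean] at hb
      linarith [bU p, bV₃ p, m1 p, m1 (p + e₁.symm (0, 1, 0)), r1 p,
        r1 (p + e₁.symm (0, 0, 1)), r1 (p + e₁.symm (0, 1, 0)), n1 (p + e₁.symm (0, 0, 1)),
        n4 (p + e₁.symm (0, 0, 1))])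
  have hlf' : FlipInvariant fun p => 1 - l p := fun p => by simp only [hlf p]
  have hkf' : FlipInvariant fun p => 1 - k p := fun p => by simp only [hkf p]
  have hd := diagEntry_nonneg hW₁
  have hl0 := fun p => (hl p).1
  have hk0 := fun p => (hk p).1
  have hl1 : ∀ p, 0 ≤ 1 - l p := fun p => sub_nonneg.2 (hl p).2
  have hk1 : ∀ p, 0 ≤ 1 - k p := fun p => sub_nonneg.2 (hk p).2
  rw [← h₂] at hB
  rw [← h₃] at hC
  exact ⟨_, _, rescale_add_rescale (l := l) hkf hkf' hW, rescale_mem_XSpace _ _,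
    rescale_mem_XSpace _ _, rescale_mem_dualCone he₁ hlf hkf hl0 hk0 hd hA,
    rescale_mem_dualCone he₂ hlf hkf hl0 hk0 hd hB,
    rescale_mem_dualCone he₁ hlf' hkf' hl1 hk1 hd hA',
    rescale_mem_dualCone he₃ hlf' hkf' hl1 hk1 hd hC⟩

/-- The cyclic relabelling of the three parties that puts `B` first. -/
def cyc : Idx ≃+ Idx where
  toFun p := (p.2.1, p.2.2, p.1)
  invFun p := (p.2.2, p.1, p.2.1)
  left_inv _ := rfl
  right_inv _ := rfl
  map_add' _ _ := rfl

theorem alpha_eq_sepCone : alpha = sepCone (AddEquiv.refl Idx) := rfl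

theorem beta_eq_sepCone : beta = sepCone cyc := rfl

theorem gamma_eq_sepCone : gamma = sepCone cyc.symm := rfl

/-- The distributive law for one of the three cones, stated for any cone `R` whose dual is
the meet that describes `Q°`. -/
theorem dualConeX_sup_eq {e₁ e₂ e₃ : Idx ≃+ Idx} (he₁ : e₁.symm (1, 1, 1) = (1, 1, 1))
    (he₂ : e₂.symm (1, 1, 1) = (1, 1, 1)) (he₃ : e₃.symm (1, 1, 1) = (1, 1, 1))
    (h₂ : e₂.symm (1, 0, 0) = e₁.symm (0, 1, 0)) (h₃ : e₃.symm (1, 0, 0) = e₁.symm (0, 0, 1))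
    {R : PointedCone ℝ Herm}
    (hR : dualCone R =
      (dualCone (sepCone e₁) ⊔ (dualCone (sepCone e₂) ⊓ dualCone (sepCone e₃))) ⊓
      (dualCone (sepCone e₂) ⊔ (dualCone (sepCone e₃) ⊓ dualCone (sepCone e₁))) ⊓
      (dualCone (sepCone e₃) ⊔ (dualCone (sepCone e₁) ⊓ dualCone (sepCone e₂)))) :
    (dualConeX (sepCone e₁) ⊓ dualConeX (sepCone e₂)) ⊔
        (dualConeX (sepCone e₁) ⊓ dualConeX (sepCone e₃)) =
      dualConeX (sepCone e₁) ⊓ dualConeX R := by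
  unfold dualConeX
  rw [hR]
  apply le_antisymm
  · refine sup_le ?_ ?_
    · rintro W ⟨⟨h1, hX⟩, h2, -⟩
      exact ⟨⟨h1, hX⟩, ⟨⟨Submodule.mem_sup_left h1, Submodule.mem_sup_left h2⟩,
        Submodule.mem_sup_right ⟨h1, h2⟩⟩, hX⟩
    · rintro W ⟨⟨h1, hX⟩, h3, -⟩
      exact ⟨⟨h1, hX⟩, ⟨⟨Submodule.mem_sup_left h1, Submodule.mem_sup_right ⟨h3, h1⟩⟩,
        Submodule.mem_sup_left h3⟩, hX⟩
  · rintro W ⟨⟨h1, hX⟩, ⟨⟨-, h2⟩, h3⟩, -⟩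
    obtain ⟨S, T, rfl, hSX, hTX, hS₁, hS₂, hT₁, hT₃⟩ :=
      exists_decomposition he₁ he₂ he₃ h₂ h₃ hX h1 h2 h3
    exact Submodule.add_mem_sup ⟨⟨hS₁, hSX⟩, hS₂, hSX⟩ ⟨⟨hT₁, hTX⟩, hT₃, hTX⟩

end ThreeQubit

theorem corollary5p2 :
    dualCone Q =
        (dualCone alpha ⊔
            (dualCone beta ⊓ dualCone gamma)) ⊓
          (dualCone beta ⊔
            (dualCone gamma ⊓ dualCone alpha)) ⊓
          (dualCone gamma ⊔
            (dualCone alpha ⊓ dualCone beta)) ∧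
      (dualConeX alpha ⊓ dualConeX beta) ⊔
          (dualConeX alpha ⊓ dualConeX gamma) =
        dualConeX alpha ⊓ dualConeX Q ∧
      (dualConeX beta ⊓ dualConeX gamma) ⊔
          (dualConeX beta ⊓ dualConeX alpha) =
        dualConeX beta ⊓ dualConeX Q ∧
      (dualConeX gamma ⊓ dualConeX alpha) ⊔
          (dualConeX gamma ⊓ dualConeX beta) =
        dualConeX gamma ⊓ dualConeX Q := by
  refine ⟨dualCone_Q, ?_, ?_, ?_⟩
  · exact dualConeX_sup_eq (e₁ := AddEquiv.refl Idx) (e₂ := cyc) (e₃ := cyc.symm) rfl rfl rfl rfl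
      rfl dualCone_Q
  · refine dualConeX_sup_eq (e₁ := cyc) (e₂ := cyc.symm) (e₃ := AddEquiv.refl Idx) rfl rfl rfl rfl
      rfl ?_
    rw [dualCone_Q, ← alpha_eq_sepCone, ← beta_eq_sepCone, ← gamma_eq_sepCone]
    ac_rfl
  · refine dualConeX_sup_eq (e₁ := cyc.symm) (e₂ := AddEquiv.refl Idx) (e₃ := cyc) rfl rfl rfl rfl
      rfl ?_
    rw [dualCone_Q, ← alpha_eq_sepCone, ← beta_eq_sepCone, ← gamma_eq_sepCone]
    ac_rfl
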